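/- Fix $J\in\{1/2,1,3/2,\dots\}$, a real $\Delta>2J$, an integer $K\ge 4J^2$ and a real $\delta>0$. For $L\ge 2$ let $\mathbf M_L$ be the set of all functions $m:\{1,\dots,L\}\to\{0,1,\dots,2J\}$ (occupation numbers; they correspond to the finite ordered multisets in $\{1,\dots,L\}$ in which no site occurs more than $2J$ times), and $\mathbf M_L^N=\{m\in\mathbf M_L:\sum_j m(j)=N\}$. Write $m\sim n$ if there is $j_0\in\{1,\dots,L-1\}$ such that $(m(j_0)-n(j_0),\,m(j_0+1)-n(j_0+1))\in\{(1,-1),(-1,1)\}$ and $m(j)=n(j)$ for all other $j$. Let $H_N$ be the operator on $\ell^2(\mathbf M_L^N)$ given by $$(H_Nf)(m)=-\frac1{2\Delta}\sum_{n\sim m}w(m,n)f(n)+V(m)f(m),$$ $$w(m,n)=\prod_{j:\,m(j)\ne n(j)}\bigl(J(m(j)+n(j)+1)-m(j)n(j)\bigr)^{1/2},$$ $$V(m)=\sum_{j=1}^{L-1}\bigl(J(m(j)+m(j+1))-m(j)m(j+1)\bigr)+J(m(1)+m(L)).$$ For $W:\mathbf M_L\to[0,\infty)$, acting as a multiplication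 operator on $\ell^2(\mathbf M_L)=\bigoplus_{N=0}^{2JL}\ell^2(\mathbf M_L^N)$, let $Q_{K,\delta}(L,W)$ be the spectral projection of $\bigoplus_N H_N+W$ onto the interval $[0,E_{K,\delta}]$, where $E_{K,\delta}=(1-\tfrac{2J}{\Delta})(K+1-\delta)$. For $1<\ell<L$ and a normalized $\psi\in\ell^2(\mathbf M_L)=\ell^2(\mathbf M_{\{1,\dots,\ell\}})\otimes\ell^2(\mathbf M_{\{\ell+1,\dots,L\}})$ (where $\mathbf M_\Gamma$ denotes the set of all functions $\Gamma\to\{0,1,\dots,2J\}$), let $\rho_1=\mathrm{Tr}_{\{\ell+1,\dots,L\}}|\psi\rangle\langle\psi|$ be the reduced state on the first $\ell$ sites, and let $\mathcal E(\rho_\psi)=-\mathrm{Tr}(\rho_1\log\rho_1)$ (with $0\log 0=0$) be the bipartite entanglement entropy. Then $$\limsup_{\ell\to\infty}\ \limsup_{L\to\infty}\ \frac{\sup_W\sup_\psi\mathcal E(\rho_\psi)}{\log\ell}\ \le\ 2\lfloor K/J\rfloor-2,$$ where the suprema are taken over all $W:\mathbf M_L\to[0,\infty)$ and over all normalized $\psi$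 in the range of $Q_{K,\delta}(L,W)$, respectively, and a supremum over the empty set is $-\infty$. -/

import Mathlib

open Filter

noncomputable section

namespace XXZ

/-- The spin `J ∈ {1/2, 1, 3/2, …}`, parametrized by the natural number `2J`. -/
def spin (twoJ : ℕ) : ℝ := (twoJ : ℝ) / 2

/-- Occupation number functions `m : Λ → {0, …, 2J}` on a set of sites `Λ`. They label the
particle configurations: `m` corresponds to the ordered multiset in which every site `i` occurs
`m i` times. The set of all configurations of the chain of length `L` is `Config twoJ (Fin L)`
(sites are numbered `0, …, L - 1`), for all particle numbers at once. -/
abbrev Config (twoJ : ℕ) (Λ : Type) : Type := Λ → Fin (twoJ + 1)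

/-- The number of particles at site `k` (sites outside the chain are empty). -/
def occ {twoJ L : ℕ} (m : Config twoJ (Fin L)) (k : ℕ) : ℕ :=
  if h : k < L then (m ⟨k, h⟩ : ℕ) else 0

/-- The total number of particles of a configuration. -/
def particleNumber {twoJ L : ℕ} (m : Config twoJ (Fin L)) : ℕ := ∑ i, (m i : ℕ)

/-- Two configurations are adjacent if one arises from the other by moving a single particle
to a neighbouring site. -/
def Adj {twoJ L : ℕ} (m n : Config twoJ (Fin L)) : Prop :=
  ∃ i j : Fin L, (i : ℕ) + 1 = j ∧
    (((m i : ℕ) = n i + 1 ∧ (m j : ℕ) + 1 = n j) ∨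
      ((m i : ℕ) + 1 = n i ∧ (m j : ℕ) = n j + 1)) ∧
    ∀ k, k ≠ i → k ≠ j → m k = n k

/-- The weight `w(m, n) = ∏_{j : m(j) ≠ n(j)} (J (m(j) + n(j) + 1) - m(j) n(j))^{1/2}`. -/
def weight {twoJ L : ℕ} (m n : Config twoJ (Fin L)) : ℝ :=
  ∏ j ∈ Finset.univ.filter (fun j => m j ≠ n j),
    Real.sqrt (spin twoJ * ((m j : ℕ) + (n j : ℕ) + 1) - (m j : ℕ) * (n j : ℕ))

/-- The two-site potential `v(a, b) = J (a + b) - a b`. -/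
def pairPotential (twoJ a b : ℕ) : ℝ := spin twoJ * (a + b) - a * b

/-- The interaction potential with the droplet boundary field,
`V(m) = ∑_{j=1}^{L-1} v(m(j), m(j+1)) + J (m(1) + m(L))`. -/
def potential {twoJ L : ℕ} (m : Config twoJ (Fin L)) : ℝ :=
  ∑ k ∈ Finset.range (L - 1), pairPotential twoJ (occ m k) (occ m (k + 1)) +
    spin twoJ * (occ m 0 + occ m (L - 1))

open Classical in
/-- The weighted adjacency operator `A` on `ℓ²` of all configurations, the direct sum of the
operators `A_N` over all particle numbers `N`. -/
def adjacencyOp (twoJ L : ℕ) : Matrix (Config twoJ (Fin L)) (Config twoJ (Fin L)) ℂ :=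
  Matrix.of fun m n => if Adj m n then ((weight m n : ℝ) : ℂ) else 0

/-- The operator `H + W`, where `H = ⊕_N H_N`, `H_N = -(2Δ)⁻¹ A_N + V_N`, and `W` is a background
potential, as a matrix in the canonical basis of `ℓ²` of all configurations. -/
def hamiltonian {twoJ L : ℕ} (Δ : ℝ) (W : Config twoJ (Fin L) → ℝ) :
    Matrix (Config twoJ (Fin L)) (Config twoJ (Fin L)) ℂ :=
  (-(1 / (2 * (Δ : ℂ)))) • adjacencyOp twoJ L +
    Matrix.diagonal (fun m => ((potential m + W m : ℝ) : ℂ))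

/-- The energies `E_{K,δ} = (1 - 2J/Δ) (K + 1 - δ)`. -/
def energy (twoJ : ℕ) (Δ : ℝ) (K : ℕ) (δ : ℝ) : ℝ :=
  (1 - 2 * spin twoJ / Δ) * (K + 1 - δ)

/-- The spectral projection of `H + W` onto the energy interval `[0, E_{K,δ}]`: the indicator
function of this interval, applied to `H + W` in the functional calculus. -/
def spectralProj {twoJ L : ℕ} (Δ : ℝ) (K : ℕ) (δ : ℝ) (W : Config twoJ (Fin L) → ℝ) :
    Matrix (Config twoJ (Fin L)) (Config twoJ (Fin L)) ℂ :=
  cfc (Set.indicator (Set.Icc 0 (energy twoJ Δ K δ)) (fun _ => (1 : ℝ))) (hamiltonian Δ W)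

/-- The first `ℓ` sites of the chain of length `L`. -/
abbrev LeftSites (L ℓ : ℕ) : Type := {i : Fin L // (i : ℕ) < ℓ}

/-- The remaining sites of the chain of length `L`. -/
abbrev RightSites (L ℓ : ℕ) : Type := {i : Fin L // ¬ (i : ℕ) < ℓ}

/-- The configuration `X ∪ Y` composed of a configuration `X` of the first `ℓ` sites and a
configuration `Y` of the others. -/
def glue {twoJ L ℓ : ℕ} (X : Config twoJ (LeftSites L ℓ)) (Y : Config twoJ (RightSites L ℓ)) :
    Config twoJ (Fin L) :=
  fun i => if h : (i : ℕ) < ℓ then X ⟨i, h⟩ else Y ⟨i, h⟩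

/-- The reduced state `ρ₁ = Tr_{Λ_ℓᶜ} |ψ⟩⟨ψ|`, with the matrix elements
`⟨φ_{X₁}, ρ₁ φ_{X₂}⟩ = ∑_Y ψ(X₁ ∪ Y) conj(ψ(X₂ ∪ Y))`. -/
def reducedState {twoJ L : ℕ} (ℓ : ℕ) (ψ : EuclideanSpace ℂ (Config twoJ (Fin L))) :
    Matrix (Config twoJ (LeftSites L ℓ)) (Config twoJ (LeftSites L ℓ)) ℂ :=
  Matrix.of fun X₁ X₂ =>
    ∑ Y : Config twoJ (RightSites L ℓ), ψ (glue X₁ Y) * star (ψ (glue X₂ Y))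

/-- The von Neumann entropy `-Tr (ρ log ρ)`, with `0 log 0 = 0`
(`Real.negMulLog x = -x * Real.log x`, and `Real.negMulLog 0 = 0`). -/
def vonNeumannEntropy {n : Type} [Fintype n] [DecidableEq n] (ρ : Matrix n n ℂ) : ℝ :=
  (cfc Real.negMulLog ρ).trace.re

/-- The bipartite entanglement entropy of the pure state `ψ` with respect to the first `ℓ` sites
and the rest of the chain. -/
def entanglementEntropy {twoJ L : ℕ} (ℓ : ℕ)
    (ψ : EuclideanSpace ℂ (Config twoJ (Fin L))) : ℝ :=
  vonNeumannEntropy (reducedState ℓ ψ)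

/-- `sup_W sup_ψ 𝓔(ρ_ψ)`: the supremum of the entanglement entropy over all non-negative
background potentials `W` and all normalized `ψ` in the range of the spectral projection of
`H + W` onto `[0, E_{K,δ}]`, in the extended real numbers. -/
def maxEntropy (twoJ : ℕ) (Δ : ℝ) (K : ℕ) (δ : ℝ) (L ℓ : ℕ) : EReal :=
  ⨆ (W : Config twoJ (Fin L) → ℝ) (_ : ∀ m, 0 ≤ W m)
    (ψ : EuclideanSpace ℂ (Config twoJ (Fin L)))
    (_ : ψ ∈ LinearMap.range (Matrix.toEuclideanLin (spectralProj Δ K δ W)))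
    (_ : ‖ψ‖ = 1), (entanglementEntropy ℓ ψ : EReal)

/-! The following facts show that the functional calculus above is applied to Hermitian matrices
only, and that `H + W` is the direct sum of its restrictions to fixed particle numbers. -/

theorem Adj.symm {twoJ L : ℕ} {m n : Config twoJ (Fin L)} (h : Adj m n) : Adj n m := by
  obtain ⟨i, j, hij, h1, h2⟩ := h
  refine ⟨i, j, hij, ?_, fun k hk hk' => (h2 k hk hk').symm⟩
  omega

theorem weight_comm {twoJ L : ℕ} (m n : Config twoJ (Fin L)) : weight m n = weight n m := by
  unfold weight
  have : (Finset.univ.filter fun j => m j ≠ n j) = Finset.univ.filter fun j => n j ≠ m j := by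
    ext j
    simp [ne_comm]
  rw [this]
  refine Finset.prod_congr rfl fun j _ => ?_
  congr 1
  ring

theorem hamiltonian_isHermitian {twoJ L : ℕ} (Δ : ℝ) (W : Config twoJ (Fin L) → ℝ) :
    (hamiltonian Δ W).IsHermitian := by
  ext m n
  have hA : ∀ m n : Config twoJ (Fin L), Adj m n ↔ Adj n m :=
    fun m n => ⟨Adj.symm, Adj.symm⟩
  by_cases h : m = n
  · subst h
    by_cases h' : Adj m m <;>
      simp [hamiltonian, adjacencyOp, h']
  · by_cases h' : Adj m n
    · simp [hamiltonian, adjacencyOp, h', (hA m n).1 h', h, Ne.symm h, weight_comm n m]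
    · simp [hamiltonian, adjacencyOp, h', mt (hA m n).2 h', h, Ne.symm h]

theorem reducedState_isHermitian {twoJ L : ℕ} (ℓ : ℕ)
    (ψ : EuclideanSpace ℂ (Config twoJ (Fin L))) : (reducedState ℓ ψ).IsHermitian := by
  ext X₁ X₂
  simp [reducedState, mul_comm]

theorem Adj.particleNumber_eq {twoJ L : ℕ} {m n : Config twoJ (Fin L)} (h : Adj m n) :
    particleNumber m = particleNumber n := by
  obtain ⟨i, j, hij, h1, h2⟩ := h
  have hne : j ≠ i := by
    rintro rfl
    omega
  have key : ∀ f : Fin L → ℕ,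
      ∑ k, f k = f i + (f j + ∑ k ∈ (Finset.univ.erase i).erase j, f k) := by
    intro f
    rw [Finset.add_sum_erase _ f (Finset.mem_erase.2 ⟨hne, Finset.mem_univ j⟩),
      Finset.add_sum_erase _ f (Finset.mem_univ i)]
  have hs : ∑ k ∈ (Finset.univ.erase i).erase j, (m k : ℕ) =
      ∑ k ∈ (Finset.univ.erase i).erase j, (n k : ℕ) := by
    refine Finset.sum_congr rfl fun k hk => ?_
    simp only [Finset.mem_erase] at hk
    rw [h2 k hk.2.1 hk.1]
  unfold particleNumber
  rw [key fun k => (m k : ℕ), key fun k => (n k : ℕ), hs]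
  omega

theorem hamiltonian_apply_eq_zero {twoJ L : ℕ} (Δ : ℝ) (W : Config twoJ (Fin L) → ℝ)
    {m n : Config twoJ (Fin L)} (h : particleNumber m ≠ particleNumber n) :
    hamiltonian Δ W m n = 0 := by
  have h1 : ¬ Adj m n := fun h' => h h'.particleNumber_eq
  have h2 : m ≠ n := fun h' => h (by rw [h'])
  simp [hamiltonian, adjacencyOp, h1, h2]

end XXZ

end

/-!
The entropy of a normalized state in the range of the spectral projection is at most
`D log ℓ + C`, where `D = ⌊K / J⌋` and `C` depends neither on `ℓ` and `L` nor on `W`. The theorem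
follows because `K ≥ 4J²` gives `D ≥ 2`, that is `D ≤ 2D - 2`.

*Few defects.* Every bond contributes `0` to the potential if both of its sites are empty or both
are full, and at least `J` otherwise; bonds of the second kind are called defects. Hence
configurations with `V ≤ K` have at most `D` defects. The `spread` of a configuration is the least
`r` such that all its defects lie within distance `r` of `D` centers. It vanishes if `V ≤ K`, so
`V ≥ K + 1` where it is positive (`V` is an integer), and it changes by at most one when a particle
hops, because particles hop across defects only.

*Localization.* For the hopping operator one has `A ≤ 2V` (`sum_weight_mul_le`). It still holds
with a factor `b` slightly above `1` after conjugation with the weight `b ^ spread`, so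
`Re ⟨g u, (H + W) u⟩ ≥ (1 - b / Δ) (K + 1) (⟨u, g u⟩ - ⟨u, u⟩)` with `g = b ^ (2 spread)`
(`weighted_form_bound`). Testing this with the eigenvectors of `Q g Q`, where `Q` is the spectral
projection, bounds `⟨ψ, g ψ⟩` on the whole range of `Q` (`sum_weight_le`), and with it the mean of
the spread in the distribution `|ψ|²` (`exists_spread_bound`).

*Entropy.* There are at most `ℓ ^ D B ^ (r + 1)` configurations of the first `ℓ` sites of spread
at most `r` (`card_covers_le`): a configuration is constant away from its defects. By Gibbs'
inequality (`vonNeumannEntropy_le`) the entropy of the reduced state is at most its cross entropy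
relative to the subprobability `q = ℓ ^ (-D) (2 B) ^ (-(spread + 1))`, which is
`D log ℓ + (1 + mean spread) log (2 B)`.
-/

namespace XXZ

open scoped ComplexOrder

variable {twoJ L : ℕ}

/-! ### The entropy as a Gibbs variational quantity -/

lemma negMulLog_le_neg_mul_log_add {x y : ℝ} (hx : 0 ≤ x) (hy : 0 < y) :
    Real.negMulLog x ≤ x * (-Real.log y) + (y - x) := by
  rcases hx.eq_or_lt with rfl | hx
  · simpa using hy.le
  · have h := Real.log_le_sub_one_of_pos (div_pos hy hx)
    rw [Real.log_div hy.ne' hx.ne'] at h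
    have h2 := mul_le_mul_of_nonneg_left h hx.le
    have h3 : x * (y / x - 1) = y - x := by field_simp
    rw [h3] at h2
    unfold Real.negMulLog
    linarith

/-- The diagonal entries of `f(A)` are averages of the values of `f` at the eigenvalues of `A`. -/
lemma cfc_apply_self_re {n : Type} [Fintype n] [DecidableEq n] {A : Matrix n n ℂ}
    (hA : A.IsHermitian) (f : ℝ → ℝ) (x : n) :
    (cfc f A x x).re =
      ∑ i, f (hA.eigenvalues i) * ‖(hA.eigenvectorUnitary : Matrix n n ℂ) x i‖ ^ 2 := by
  rw [hA.cfc_eq f, Matrix.IsHermitian.cfc, Unitary.conjStarAlgAut_apply, Matrix.mul_apply,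
    Complex.re_sum]
  refine Finset.sum_congr rfl fun i _ => ?_
  rw [Matrix.mul_diagonal, Matrix.star_apply, mul_right_comm, RCLike.star_def, Complex.mul_conj,
    Complex.normSq_eq_norm_sq]
  simp only [Function.comp_apply, Complex.coe_algebraMap]
  norm_cast
  rw [mul_comm]

/-- Dephasing in the canonical basis followed by Gibbs' inequality: the entropy of `ρ` is at most
the cross entropy of its diagonal relative to a subprobability `q`. -/
lemma vonNeumannEntropy_le {n : Type} [Fintype n] [DecidableEq n] {ρ : Matrix n n ℂ}
    (hρ : ρ.PosSemidef) (htr : ∑ x, (ρ x x).re = 1) (q : n → ℝ) (hq : ∀ x, 0 < q x)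
    (hq1 : ∑ x, q x ≤ 1) :
    vonNeumannEntropy ρ ≤ ∑ x, (ρ x x).re * (-Real.log (q x)) := by
  have hH := hρ.1
  set c : n → n → ℝ := fun x i => ‖(hH.eigenvectorUnitary : Matrix n n ℂ) x i‖ ^ 2 with hc
  have hc1 : ∀ x, ∑ i, c x i = 1 := by
    intro x
    have h := cfc_apply_self_re hH (fun _ => (1 : ℝ)) x
    have e : cfc (fun _ : ℝ => (1 : ℝ)) ρ = 1 := cfc_const_one ℝ ρ hH
    rw [e] at h
    simpa [hc] using h.symm
  have hid : ∀ x, (ρ x x).re = ∑ i, hH.eigenvalues i * c x i := by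
    intro x
    have h := cfc_apply_self_re hH id x
    have e : cfc (id : ℝ → ℝ) ρ = ρ := cfc_id ℝ ρ hH
    rwa [e] at h
  have hS : vonNeumannEntropy ρ = ∑ x, ∑ i, Real.negMulLog (hH.eigenvalues i) * c x i := by
    unfold vonNeumannEntropy
    rw [Matrix.trace, Complex.re_sum]
    exact Finset.sum_congr rfl fun x _ => cfc_apply_self_re hH _ x
  have hx : ∀ x, ∑ i, Real.negMulLog (hH.eigenvalues i) * c x i ≤
      (ρ x x).re * (-Real.log (q x)) + (q x - (ρ x x).re) := by
    intro x
    calc ∑ i, Real.negMulLog (hH.eigenvalues i) * c x i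
        ≤ ∑ i, (hH.eigenvalues i * (-Real.log (q x)) + (q x - hH.eigenvalues i)) * c x i :=
          Finset.sum_le_sum fun i _ => mul_le_mul_of_nonneg_right
            (negMulLog_le_neg_mul_log_add (hρ.eigenvalues_nonneg i) (hq x)) (by positivity)
      _ = (∑ i, hH.eigenvalues i * c x i) * (-Real.log (q x)) +
            (q x * ∑ i, c x i - ∑ i, hH.eigenvalues i * c x i) := by
          rw [Finset.sum_mul, Finset.mul_sum, ← Finset.sum_sub_distrib, ← Finset.sum_add_distrib]
          exact Finset.sum_congr rfl fun i _ => by ring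
      _ = _ := by rw [← hid, hc1, mul_one]
  calc vonNeumannEntropy ρ
      ≤ ∑ x, ((ρ x x).re * (-Real.log (q x)) + (q x - (ρ x x).re)) :=
        hS.le.trans (Finset.sum_le_sum fun x _ => hx x)
    _ = ∑ x, (ρ x x).re * (-Real.log (q x)) + (∑ x, q x - 1) := by
        rw [Finset.sum_add_distrib, Finset.sum_sub_distrib, htr]
    _ ≤ _ := by linarith

/-! ### The reduced state -/

/-- The restriction of a configuration of the chain to its first `ℓ` sites. -/
def leftPart (ℓ : ℕ) (m : Config twoJ (Fin L)) : Config twoJ (LeftSites L ℓ) := fun i => m i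

lemma reducedState_posSemidef (ℓ : ℕ) (ψ : EuclideanSpace ℂ (Config twoJ (Fin L))) :
    (reducedState ℓ ψ).PosSemidef := by
  have h : reducedState ℓ ψ =
      (Matrix.of fun (X : Config twoJ (LeftSites L ℓ)) (Y : Config twoJ (RightSites L ℓ)) =>
        ψ (glue X Y)) * (Matrix.of fun (X : Config twoJ (LeftSites L ℓ))
          (Y : Config twoJ (RightSites L ℓ)) => ψ (glue X Y)).conjTranspose := by
    ext X₁ X₂
    simp [reducedState, Matrix.mul_apply]
  rw [h]
  exact Matrix.posSemidef_self_mul_conjTranspose _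

/-- The diagonal of the reduced state is the marginal on the left sites of the probability
distribution `|ψ|²` on configurations. -/
lemma sum_reducedState_diag (ℓ : ℕ) (ψ : EuclideanSpace ℂ (Config twoJ (Fin L)))
    (f : Config twoJ (LeftSites L ℓ) → ℝ) :
    ∑ X, (reducedState ℓ ψ X X).re * f X = ∑ m, ‖ψ m‖ ^ 2 * f (leftPart ℓ m) := by
  have h : ∀ X, (reducedState ℓ ψ X X).re * f X =
      ∑ Y : Config twoJ (RightSites L ℓ), ‖ψ (glue X Y)‖ ^ 2 * f X := by
    intro X
    rw [← Finset.sum_mul]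
    congr 1
    simp only [reducedState, Matrix.of_apply, Complex.re_sum, RCLike.star_def, Complex.mul_conj,
      Complex.normSq_eq_norm_sq, Complex.ofReal_re]
  simp_rw [h]
  rw [← Fintype.sum_prod_type']
  refine (Fintype.sum_equiv (Equiv.piEquivPiSubtypeProd (fun i : Fin L => (i : ℕ) < ℓ)
    (fun _ => Fin (twoJ + 1))) _ _ fun m => ?_).symm
  have hg : glue (fun i : LeftSites L ℓ => m i) (fun i : RightSites L ℓ => m i) = m := by
    funext i
    simp [glue]
  change _ = ‖ψ (glue (fun i : LeftSites L ℓ => m i) (fun i : RightSites L ℓ => m i))‖ ^ 2 * _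
  rw [hg]
  rfl

/-! ### Weighted estimates on spectral subspaces -/

lemma posSemidef_of_eigenvalues {n : Type} [Fintype n] [DecidableEq n] {M : Matrix n n ℂ}
    (hM : M.IsHermitian)
    (h : ∀ (μ : ℝ) (u : n → ℂ), u ≠ 0 → M.mulVec u = (μ : ℂ) • u → 0 ≤ μ) : M.PosSemidef := by
  rw [hM.posSemidef_iff_eigenvalues_nonneg]
  intro i
  refine h _ (hM.eigenvectorBasis i).ofLp ?_ ?_
  · intro h0
    have := hM.eigenvectorBasis.orthonormal.ne_zero i
    exact this (by ext j; simpa using congrFun h0 j)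
  · rw [hM.mulVec_eigenvectorBasis]
    ext j
    simp

lemma re_star_dotProduct_self {n : Type} [Fintype n] (u : n → ℂ) :
    star u ⬝ᵥ u = ((∑ i, ‖u i‖ ^ 2 : ℝ) : ℂ) := by
  simp only [dotProduct, Pi.star_apply, RCLike.star_def]
  push_cast
  exact Finset.sum_congr rfl fun i _ => by
    rw [mul_comm, Complex.mul_conj, Complex.normSq_eq_norm_sq]; norm_cast

lemma star_dotProduct_diagonal {n : Type} [Fintype n] [DecidableEq n] (g : n → ℝ) (u : n → ℂ) :
    star u ⬝ᵥ (Matrix.diagonal (fun i => (g i : ℂ))).mulVec u =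
      ((∑ i, g i * ‖u i‖ ^ 2 : ℝ) : ℂ) := by
  simp only [dotProduct, Pi.star_apply, RCLike.star_def, Matrix.mulVec_diagonal]
  push_cast
  refine Finset.sum_congr rfl fun i _ => ?_
  have h : u i * (starRingEnd ℂ) (u i) = ((‖u i‖ : ℂ)) ^ 2 := by
    rw [Complex.mul_conj, Complex.normSq_eq_norm_sq]; norm_cast
  rw [← h]; ring

/-- A Combes–Thomas type estimate for all vectors of a spectral subspace at once. The projection
`Q` commutes with `H`, on its range `H ≤ E`, and the weight `g` satisfies
`Re ⟨g u, H u⟩ ≥ A (⟨u, g u⟩ - ⟨u, u⟩)` with `A > E`. If `u` is an eigenvector of the compression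
`Q g Q` with eigenvalue `λ > 0`, then `⟨g u, H u⟩ = λ ⟨u, H u⟩ ≤ λ E`, which bounds `λ`. -/
lemma sum_weight_le {n : Type} [Fintype n] [DecidableEq n] {H Q : Matrix n n ℂ}
    (hQ : Q.IsHermitian) (hQQ : Q * Q = Q) (hHQ : H * Q = Q * H) {E A : ℝ} (hA : 0 < A)
    (hEA : E < A)
    (hE : ∀ u, Q.mulVec u = u → (star u ⬝ᵥ H.mulVec u).re ≤ E * ∑ i, ‖u i‖ ^ 2) (g : n → ℝ)
    (hg : ∀ u, A * (∑ i, g i * ‖u i‖ ^ 2 - ∑ i, ‖u i‖ ^ 2) ≤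
      (star ((Matrix.diagonal (fun i => (g i : ℂ))).mulVec u) ⬝ᵥ H.mulVec u).re)
    (ψ : n → ℂ) (hψ : Q.mulVec ψ = ψ) :
    ∑ i, g i * ‖ψ i‖ ^ 2 ≤ A / (A - E) * ∑ i, ‖ψ i‖ ^ 2 := by
  set G : Matrix n n ℂ := Matrix.diagonal (fun i => (g i : ℂ)) with hG
  set C : ℝ := A / (A - E) with hC
  have hC0 : 0 < C := div_pos hA (by linarith)
  have hGH : G.IsHermitian := by
    rw [hG, Matrix.IsHermitian, Matrix.diagonal_conjTranspose]
    congr 1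
    ext i
    simp
  have hQv : ∀ u, Matrix.vecMul (star u) Q = star (Q.mulVec u) := fun u => by
    rw [Matrix.star_mulVec, hQ.eq]
  have hquad : ∀ u, Q.mulVec u = u →
      star u ⬝ᵥ (Q * G * Q).mulVec u = ((∑ i, g i * ‖u i‖ ^ 2 : ℝ) : ℂ) := by
    intro u hu
    rw [← star_dotProduct_diagonal g u, ← hG, ← Matrix.mulVec_mulVec, hu, ← Matrix.mulVec_mulVec,
      Matrix.dotProduct_mulVec, hQv, hu]
  have hBH : (Q * G * Q).IsHermitian := by
    rw [Matrix.IsHermitian, Matrix.conjTranspose_mul, Matrix.conjTranspose_mul, hQ.eq, hGH.eq,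
      mul_assoc]
  have hMH : (((C : ℂ) • (1 : Matrix n n ℂ)) - Q * G * Q).IsHermitian := by
    refine Matrix.IsHermitian.sub ?_ hBH
    rw [Matrix.IsHermitian, Matrix.conjTranspose_smul, Matrix.conjTranspose_one]
    simp
  have hpos : (((C : ℂ) • (1 : Matrix n n ℂ)) - Q * G * Q).PosSemidef := by
    refine posSemidef_of_eigenvalues hMH fun μ u hu hμ => ?_
    by_contra hneg
    rw [not_le] at hneg
    set l : ℝ := C - μ with hl
    have hl0 : 0 < l := by linarith
    have hBu : (Q * G * Q).mulVec u = (l : ℂ) • u := by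
      rw [Matrix.sub_mulVec, Matrix.smul_mulVec, Matrix.one_mulVec] at hμ
      rw [hl, Complex.ofReal_sub, sub_smul, ← hμ]
      abel
    have hQu : Q.mulVec u = u := by
      have h1 : Q.mulVec ((l : ℂ) • u) = (l : ℂ) • u := by
        rw [← hBu, Matrix.mulVec_mulVec, ← mul_assoc, ← mul_assoc, hQQ]
      rw [Matrix.mulVec_smul] at h1
      exact smul_right_injective _ (by exact_mod_cast hl0.ne') h1
    have hN : 0 < ∑ i, ‖u i‖ ^ 2 := by
      obtain ⟨i, hi⟩ := Function.ne_iff.1 hu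
      exact Finset.sum_pos' (fun i _ => by positivity)
        ⟨i, Finset.mem_univ i, by have := norm_pos_iff.2 hi; positivity⟩
    have h1 : ∑ i, g i * ‖u i‖ ^ 2 = l * ∑ i, ‖u i‖ ^ 2 := by
      have := hquad u hQu
      rw [hBu, dotProduct_smul, re_star_dotProduct_self, smul_eq_mul] at this
      exact_mod_cast this.symm
    have h2 : star (G.mulVec u) ⬝ᵥ H.mulVec u = (l : ℂ) * (star u ⬝ᵥ H.mulVec u) := by
      have h3 : H.mulVec u = Q.mulVec (H.mulVec u) := by
        rw [Matrix.mulVec_mulVec, ← hHQ, ← Matrix.mulVec_mulVec, hQu]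
      have h4 : Q.mulVec (G.mulVec u) = (l : ℂ) • u := by
        rw [← hBu, ← Matrix.mulVec_mulVec, ← Matrix.mulVec_mulVec, hQu]
      rw [h3, Matrix.dotProduct_mulVec, hQv, h4, ← h3, star_smul,
        smul_dotProduct]
      simp
    have h5 := hg u
    have h6 := hE u hQu
    rw [h2, Complex.re_ofReal_mul, h1] at h5
    have h7 : A * (l - 1) ≤ l * E := by
      by_contra hlt
      rw [not_le] at hlt
      nlinarith [mul_le_mul_of_nonneg_left h6 hl0.le]
    have h8 : l ≤ C := by
      rw [hC, le_div_iff₀ (by linarith)]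
      linarith
    linarith
  have := hpos.re_dotProduct_nonneg ψ
  rw [Matrix.sub_mulVec, Matrix.smul_mulVec, Matrix.one_mulVec, dotProduct_sub, hquad ψ hψ,
    dotProduct_smul, re_star_dotProduct_self, smul_eq_mul, ← Complex.ofReal_mul,
    ← Complex.ofReal_sub] at this
  have h9 : (0 : ℝ) ≤ C * ∑ i, ‖ψ i‖ ^ 2 - ∑ i, g i * ‖ψ i‖ ^ 2 := this
  linarith

section SpectralProjection

variable (Δ : ℝ) (K : ℕ) (δ : ℝ) (W : Config twoJ (Fin L) → ℝ)

lemma spectralProj_isHermitian : (spectralProj Δ K δ W).IsHermitian :=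
  cfc_predicate _ _

lemma continuousOn_spectrum_hamiltonian (f : ℝ → ℝ) :
    ContinuousOn f (spectrum ℝ (hamiltonian Δ W)) :=
  (Matrix.finite_real_spectrum (A := hamiltonian Δ W)).continuousOn f

lemma spectralProj_mul_self :
    spectralProj Δ K δ W * spectralProj Δ K δ W = spectralProj Δ K δ W := by
  unfold spectralProj
  rw [← cfc_mul _ _ _ (continuousOn_spectrum_hamiltonian Δ W _)
    (continuousOn_spectrum_hamiltonian Δ W _)]
  congr 1
  ext x
  by_cases hx : x ∈ Set.Icc 0 (energy twoJ Δ K δ) <;> simp [Set.indicator, hx]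

lemma hamiltonian_mul_spectralProj_comm :
    hamiltonian Δ W * spectralProj Δ K δ W = spectralProj Δ K δ W * hamiltonian Δ W := by
  have h := cfc_commute_cfc (R := ℝ) id
    (Set.indicator (Set.Icc 0 (energy twoJ Δ K δ)) (fun _ => (1 : ℝ))) (hamiltonian Δ W)
  have e : cfc (id : ℝ → ℝ) (hamiltonian Δ W) = hamiltonian Δ W :=
    cfc_id ℝ _ (hamiltonian_isHermitian Δ W)
  rw [e] at h
  exact h

open scoped MatrixOrder in
lemma re_dotProduct_hamiltonian_le (u : Config twoJ (Fin L) → ℂ)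
    (hu : (spectralProj Δ K δ W).mulVec u = u) :
    (star u ⬝ᵥ (hamiltonian Δ W).mulVec u).re ≤ energy twoJ Δ K δ * ∑ m, ‖u m‖ ^ 2 := by
  set E := energy twoJ Δ K δ with hE
  set f := Set.indicator (Set.Icc 0 E) (fun _ => (1 : ℝ)) with hf
  have h0 : 0 ≤ cfc (fun x => (E - x) * f x) (hamiltonian Δ W) := by
    refine cfc_nonneg fun x _ => ?_
    by_cases hx : x ∈ Set.Icc 0 E
    · simpa [hf, Set.indicator, hx] using hx.2
    · simp [hf, hx]
  have e1 : cfc (fun _ : ℝ => E) (hamiltonian Δ W) = algebraMap ℝ _ E :=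
    cfc_const E _ (hamiltonian_isHermitian Δ W)
  have e2 : cfc (fun x : ℝ => x) (hamiltonian Δ W) = hamiltonian Δ W :=
    cfc_id' ℝ _ (hamiltonian_isHermitian Δ W)
  rw [cfc_mul _ _ _ (continuousOn_spectrum_hamiltonian Δ W _)
    (continuousOn_spectrum_hamiltonian Δ W _), cfc_sub _ _ _
    (continuousOn_spectrum_hamiltonian Δ W _) (continuousOn_spectrum_hamiltonian Δ W _),
    e1, e2,
    Matrix.nonneg_iff_posSemidef] at h0
  have h1 := h0.re_dotProduct_nonneg u
  have h2 : (cfc f (hamiltonian Δ W)).mulVec u = u := hu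
  rw [← Matrix.mulVec_mulVec, h2, Matrix.sub_mulVec, dotProduct_sub,
    Matrix.algebraMap_eq_diagonal] at h1
  have h3 : star u ⬝ᵥ (Matrix.diagonal ((algebraMap ℝ (Config twoJ (Fin L) → ℂ)) E)).mulVec u =
      ((∑ m, E * ‖u m‖ ^ 2 : ℝ) : ℂ) := star_dotProduct_diagonal (fun _ => E) u
  rw [h3, map_sub] at h1
  rw [Finset.mul_sum]
  have h4 : (RCLike.re (((∑ m, E * ‖u m‖ ^ 2 : ℝ) : ℂ)) : ℝ) = ∑ m, E * ‖u m‖ ^ 2 := by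
    exact Complex.ofReal_re _
  rw [h4] at h1
  exact sub_nonneg.1 h1

end SpectralProjection

/-! ### The hopping term is bounded by the potential -/

/-- A single particle moves from site `i` to site `j`. -/
def Hop (i j : Fin L) (m n : Config twoJ (Fin L)) : Prop :=
  (m i : ℕ) = n i + 1 ∧ (m j : ℕ) + 1 = n j ∧ ∀ k, k ≠ i → k ≠ j → m k = n k

/-- The rate `m(i) (2J - m(j))` of a jump from `i` to `j`. For a jump `m → n` across a bond,
`w(m, n)²` is the product of the rates of this jump and of the reverse jump. -/
noncomputable def hopRate (i j : Fin L) (m : Config twoJ (Fin L)) : ℝ := (m i : ℕ) * ((twoJ : ℝ) - (m j : ℕ))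

lemma hopRate_nonneg (i j : Fin L) (m : Config twoJ (Fin L)) : 0 ≤ hopRate i j m := by
  have : ((m j : ℕ) : ℝ) ≤ twoJ := by exact_mod_cast Nat.lt_succ_iff.1 (m j).2
  exact mul_nonneg (Nat.cast_nonneg _) (by linarith)

/-- `i` and `j` are neighbouring sites. -/
def Nbr (i j : Fin L) : Prop := (i : ℕ) + 1 = j ∨ (j : ℕ) + 1 = i

lemma Nbr.symm {i j : Fin L} (h : Nbr i j) : Nbr j i := Or.symm h

lemma Nbr.ne {i j : Fin L} (h : Nbr i j) : i ≠ j := by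
  rintro rfl
  unfold Nbr at h
  omega

lemma Hop.symm {i j : Fin L} {m n : Config twoJ (Fin L)} (h : Hop i j m n) : Hop j i n m :=
  ⟨h.2.1.symm, h.1.symm, fun k hk hk' => (h.2.2 k hk' hk).symm⟩

lemma Adj.exists_hop {m n : Config twoJ (Fin L)} (h : Adj m n) : ∃ i j, Nbr i j ∧ Hop i j m n := by
  obtain ⟨i, j, hij, h1 | h1, h2⟩ := h
  · exact ⟨i, j, Or.inl hij, h1.1, h1.2, h2⟩
  · exact ⟨j, i, Or.inr hij, h1.2, h1.1, fun k hk hk' => h2 k hk' hk⟩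

lemma Hop.unique {i j : Fin L} {m n n' : Config twoJ (Fin L)} (h : Hop i j m n)
    (h' : Hop i j m n') : n = n' := by
  funext k
  by_cases hi : k = i
  · subst hi
    have := h.1
    have := h'.1
    exact Fin.ext (by omega)
  by_cases hj : k = j
  · subst hj
    have := h.2.1
    have := h'.2.1
    exact Fin.ext (by omega)
  · rw [← h.2.2 k hi hj, ← h'.2.2 k hi hj]

lemma Hop.weight_eq {i j : Fin L} {m n : Config twoJ (Fin L)} (hij : i ≠ j) (h : Hop i j m n) :
    weight m n = Real.sqrt (hopRate i j m) * Real.sqrt (hopRate j i n) := by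
  have hs : (Finset.univ.filter fun k => m k ≠ n k) = {i, j} := by
    ext k
    simp only [Finset.mem_filter, Finset.mem_univ, true_and, Finset.mem_insert,
      Finset.mem_singleton]
    constructor
    · intro hk
      by_contra hc
      rw [not_or] at hc
      exact hk (h.2.2 k hc.1 hc.2)
    · rintro (rfl | rfl) he
      · have := h.1
        rw [he] at this
        omega
      · have := h.2.1
        rw [he] at this
        omega
  have h1 : ((m i : ℕ) : ℝ) = (n i : ℕ) + 1 := by exact_mod_cast h.1
  have h2 : ((n j : ℕ) : ℝ) = (m j : ℕ) + 1 := by exact_mod_cast h.2.1.symm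
  have hmi : ((m i : ℕ) : ℝ) ≤ twoJ := by exact_mod_cast Nat.lt_succ_iff.1 (m i).2
  have hi : spin twoJ * ((m i : ℕ) + (n i : ℕ) + 1) - (m i : ℕ) * (n i : ℕ) =
      (m i : ℕ) * ((twoJ : ℝ) - (n i : ℕ)) := by
    unfold spin
    rw [h1]; ring
  have hj : spin twoJ * ((m j : ℕ) + (n j : ℕ) + 1) - (m j : ℕ) * (n j : ℕ) =
      (n j : ℕ) * ((twoJ : ℝ) - (m j : ℕ)) := by
    unfold spin
    rw [h2]; ring
  unfold weight
  rw [hs, Finset.prod_pair hij, hi, hj, ← Real.sqrt_mul (by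
      rw [h1] at hmi ⊢; exact mul_nonneg (by positivity) (by linarith)),
    ← Real.sqrt_mul (hopRate_nonneg i j m)]
  congr 1
  unfold hopRate
  ring

lemma pairPotential_nonneg {a b : ℕ} (ha : a ≤ twoJ) (hb : b ≤ twoJ) :
    0 ≤ pairPotential twoJ a b := by
  have ha' : (a : ℝ) ≤ twoJ := by exact_mod_cast ha
  have hb' : (b : ℝ) ≤ twoJ := by exact_mod_cast hb
  unfold pairPotential spin
  nlinarith [mul_nonneg (Nat.cast_nonneg (α := ℝ) a) (sub_nonneg.2 hb'),
    mul_nonneg (Nat.cast_nonneg (α := ℝ) b) (sub_nonneg.2 ha')]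

lemma occ_le (m : Config twoJ (Fin L)) (k : ℕ) : occ m k ≤ twoJ := by
  unfold occ
  split_ifs
  · exact Nat.lt_succ_iff.1 (m _).2
  · exact Nat.zero_le _

lemma occ_coe (m : Config twoJ (Fin L)) (i : Fin L) : occ m i = m i := by
  simp [occ]

lemma sum_pairPotential_le_potential (m : Config twoJ (Fin L)) :
    ∑ k ∈ Finset.range (L - 1), pairPotential twoJ (occ m k) (occ m (k + 1)) ≤ potential m := by
  unfold potential spin
  have : (0 : ℝ) ≤ (twoJ : ℝ) / 2 * (occ m 0 + occ m (L - 1)) := by positivity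
  linarith

lemma potential_nonneg (m : Config twoJ (Fin L)) : 0 ≤ potential m :=
  (Finset.sum_nonneg fun _ _ => pairPotential_nonneg (occ_le m _) (occ_le m _)).trans
    (sum_pairPotential_le_potential m)

open Classical in
/-- The total rate of the jumps across a bond is twice its pair potential. -/
lemma sum_hopRate_le (m : Config twoJ (Fin L)) :
    ∑ i, ∑ j, (if Nbr i j then hopRate i j m else 0) ≤ 2 * potential m := by
  have key : ∑ i : Fin L, ∑ j : Fin L, (if (i : ℕ) + 1 = j then hopRate i j m + hopRate j i m
      else 0) = 2 * ∑ k ∈ Finset.range (L - 1), pairPotential twoJ (occ m k) (occ m (k + 1)) := by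
    rcases L with _ | L
    · simp
    rw [Nat.add_sub_cancel, Finset.mul_sum, Finset.sum_range, Fin.sum_univ_castSucc]
    have hlast : ∑ j : Fin (L + 1), (if ((Fin.last L : Fin (L + 1)) : ℕ) + 1 = j then
        hopRate (Fin.last L) j m + hopRate j (Fin.last L) m else 0) = 0 :=
      Finset.sum_eq_zero fun j _ => if_neg (by have := j.2; simp only [Fin.val_last]; omega)
    rw [hlast, add_zero]
    refine Finset.sum_congr rfl fun k _ => ?_
    rw [Finset.sum_eq_single k.succ]
    · rw [if_pos (by simp)]
      have h1 : occ m (k : ℕ) = m k.castSucc := occ_coe m k.castSucc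
      have h2 : occ m ((k : ℕ) + 1) = m k.succ := occ_coe m k.succ
      rw [h1, h2]
      unfold hopRate pairPotential spin
      ring
    · intro j _ hj
      refine if_neg fun h => hj (Fin.ext ?_)
      simpa using h.symm
    · simp
  have hsplit : ∀ i j : Fin L, (if Nbr i j then hopRate i j m else 0) =
      (if (i : ℕ) + 1 = j then hopRate i j m else 0) +
        (if (j : ℕ) + 1 = i then hopRate i j m else 0) := by
    intro i j
    unfold Nbr
    by_cases h1 : (i : ℕ) + 1 = j
    · have h2 : ¬ (j : ℕ) + 1 = i := by omega
      simp [h1, h2]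
    · simp [h1]
  have hsum : ∑ i, ∑ j, (if Nbr i j then hopRate i j m else 0) =
      ∑ i : Fin L, ∑ j : Fin L, (if (i : ℕ) + 1 = j then hopRate i j m + hopRate j i m
      else 0) := by
    simp_rw [hsplit, Finset.sum_add_distrib]
    nth_rewrite 2 [Finset.sum_comm]
    rw [← Finset.sum_add_distrib]
    refine Finset.sum_congr rfl fun i _ => ?_
    rw [← Finset.sum_add_distrib]
    refine Finset.sum_congr rfl fun j _ => ?_
    split_ifs <;> simp
  rw [hsum, key]
  have := sum_pairPotential_le_potential m
  linarith

open Classical in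
/-- The rate of the transition from `m` to `n`. -/
noncomputable def rate (m n : Config twoJ (Fin L)) : ℝ :=
  ∑ i, ∑ j, if Nbr i j ∧ Hop i j m n then hopRate i j m else 0

lemma rate_nonneg (m n : Config twoJ (Fin L)) : 0 ≤ rate m n :=
  Finset.sum_nonneg fun _ _ => Finset.sum_nonneg fun _ _ => by
    split_ifs
    · exact hopRate_nonneg _ _ _
    · exact le_rfl

lemma hopRate_le_rate {i j : Fin L} {m n : Config twoJ (Fin L)} (hij : Nbr i j)
    (h : Hop i j m n) : hopRate i j m ≤ rate m n := by
  classical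
  have h0 : ∀ i j : Fin L, 0 ≤ if Nbr i j ∧ Hop i j m n then hopRate i j m else 0 := by
    intro i j
    split_ifs
    · exact hopRate_nonneg _ _ _
    · exact le_rfl
  calc hopRate i j m = if Nbr i j ∧ Hop i j m n then hopRate i j m else 0 :=
        (if_pos ⟨hij, h⟩).symm
    _ ≤ ∑ j, if Nbr i j ∧ Hop i j m n then hopRate i j m else 0 :=
        Finset.single_le_sum (f := fun j => if Nbr i j ∧ Hop i j m n then hopRate i j m else 0)
          (fun j _ => h0 i j) (Finset.mem_univ j)
    _ ≤ rate m n := by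
        unfold rate
        exact Finset.single_le_sum
          (f := fun i => ∑ j, if Nbr i j ∧ Hop i j m n then hopRate i j m else 0)
          (fun i _ => Finset.sum_nonneg fun j _ => h0 i j) (Finset.mem_univ i)

lemma sum_rate_le (m : Config twoJ (Fin L)) : ∑ n, rate m n ≤ 2 * potential m := by
  classical
  refine le_trans ?_ (sum_hopRate_le m)
  unfold rate
  rw [Finset.sum_comm]
  refine Finset.sum_le_sum fun i _ => ?_
  rw [Finset.sum_comm]
  refine Finset.sum_le_sum fun j _ => ?_
  by_cases hij : Nbr i j
  · simp only [hij, true_and, if_true]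
    by_cases hex : ∃ n, Hop i j m n
    · obtain ⟨n, hn⟩ := hex
      rw [Finset.sum_eq_single n (fun n' _ hne => if_neg fun h' => hne (h'.unique hn))
        (by simp), if_pos hn]
    · rw [Finset.sum_eq_zero fun n _ => if_neg fun h => hex ⟨n, h⟩]
      exact hopRate_nonneg _ _ _
  · simp [hij]

open Classical in
/-- The form bound `A ≤ 2 V`, tested on non-negative vectors. It follows from
`2 w(m, n) u(m) u(n) ≤ rate(m, n) u(m)² + rate(n, m) u(n)²`. -/
lemma sum_weight_mul_le (u : Config twoJ (Fin L) → ℝ) :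
    ∑ m, ∑ n, (if Adj m n then weight m n else 0) * (u m * u n) ≤
      2 * ∑ m, potential m * u m ^ 2 := by
  have hpt : ∀ m n : Config twoJ (Fin L), (if Adj m n then weight m n else 0) * (u m * u n) ≤
      (rate m n * u m ^ 2 + rate n m * u n ^ 2) / 2 := by
    intro m n
    have r1 := rate_nonneg m n
    have r2 := rate_nonneg n m
    by_cases h : Adj m n
    · rw [if_pos h]
      obtain ⟨i, j, hij, hh⟩ := h.exists_hop
      rw [hh.weight_eq hij.ne]
      have h1 := hopRate_le_rate hij hh
      have h2 := hopRate_le_rate hij.symm hh.symm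
      have s1 := Real.sq_sqrt (hopRate_nonneg i j m)
      have s2 := Real.sq_sqrt (hopRate_nonneg j i n)
      nlinarith [sq_nonneg (Real.sqrt (hopRate i j m) * u m - Real.sqrt (hopRate j i n) * u n),
        mul_le_mul_of_nonneg_right h1 (sq_nonneg (u m)),
        mul_le_mul_of_nonneg_right h2 (sq_nonneg (u n))]
    · rw [if_neg h, zero_mul]
      positivity
  calc _ ≤ ∑ m, ∑ n, (rate m n * u m ^ 2 + rate n m * u n ^ 2) / 2 :=
        Finset.sum_le_sum fun m _ => Finset.sum_le_sum fun n _ => hpt m n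
    _ = ∑ m, (∑ n, rate m n) * u m ^ 2 := by
        simp_rw [← Finset.sum_div, Finset.sum_add_distrib]
        rw [Finset.sum_comm (f := fun m n => rate n m * u n ^ 2)]
        simp_rw [Finset.sum_mul]
        ring
    _ ≤ ∑ m, (2 * potential m) * u m ^ 2 :=
        Finset.sum_le_sum fun m _ => mul_le_mul_of_nonneg_right (sum_rate_le m) (sq_nonneg _)
    _ = _ := by
        rw [Finset.mul_sum]
        exact Finset.sum_congr rfl fun m _ => by ring

/-! ### Defects -/

/-- The bonds `(k, k + 1)` of the chain whose occupation numbers are neither both `0` nor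
both `2J`; a bond is labelled by its left site. -/
def defects (m : Config twoJ (Fin L)) : Set ℕ :=
  {k | k + 1 < L ∧ ¬ (occ m k = 0 ∧ occ m (k + 1) = 0) ∧
    ¬ (occ m k = twoJ ∧ occ m (k + 1) = twoJ)}

lemma defects_subset_range (m : Config twoJ (Fin L)) : defects m ⊆ Set.Iio (L - 1) := by
  intro k hk
  have := hk.1
  simp only [Set.mem_Iio]
  omega

lemma defects_finite (m : Config twoJ (Fin L)) : (defects m).Finite :=
  (Set.finite_Iio _).subset (defects_subset_range m)

lemma spin_le_pairPotential {a b : ℕ} (ha : a ≤ twoJ) (hb : b ≤ twoJ)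
    (h0 : ¬ (a = 0 ∧ b = 0)) (h1 : ¬ (a = twoJ ∧ b = twoJ)) :
    spin twoJ ≤ pairPotential twoJ a b := by
  -- `2 v(a, b) = a (2J - b) + b (2J - a)` is an integer combination of non-negative terms
  obtain ⟨c, rfl⟩ := Nat.exists_eq_add_of_le ha
  have key : a + c ≤ (a + c) * (a + b) - 2 * (a * b) ∧ 2 * (a * b) ≤ (a + c) * (a + b) := by
    obtain ⟨d, hd⟩ := Nat.exists_eq_add_of_le hb
    have e : (a + c) * (a + b) = 2 * (a * b) + (a * d + b * c) := by
      have : (a + c) * (a + b) = a * (b + d) + b * (a + c) := by rw [← hd]; ring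
      rw [this]; ring
    rw [e]
    refine ⟨?_, by omega⟩
    rw [Nat.add_sub_cancel_left]
    rcases Nat.eq_zero_or_pos a with rfl | ha0
    · have : 1 ≤ b := by omega
      simpa using Nat.mul_le_mul_right c this
    rcases Nat.eq_zero_or_pos c with rfl | hc0
    · have : 1 ≤ d := by omega
      simpa using Nat.mul_le_mul_left a this
    · rw [hd]
      nlinarith [Nat.mul_le_mul_right d ha0, Nat.mul_le_mul_left b hc0]
  have k1 : ((a : ℝ) + c) + 2 * (a * b) ≤ (a + c) * (a + b) := by
    have := key.1
    have h2 := key.2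
    have h3 : (a + c) + 2 * (a * b) ≤ (a + c) * (a + b) := by omega
    exact_mod_cast h3
  unfold spin pairPotential spin
  push_cast
  linarith

lemma spin_mul_ncard_defects_le (m : Config twoJ (Fin L)) :
    spin twoJ * (defects m).ncard ≤ potential m := by
  classical
  refine le_trans ?_ (sum_pairPotential_le_potential m)
  have hsub : (defects_finite m).toFinset ⊆ Finset.range (L - 1) := by
    intro k hk
    rw [Set.Finite.mem_toFinset] at hk
    exact Finset.mem_range.2 (defects_subset_range m hk)
  rw [Set.ncard_eq_toFinset_card _ (defects_finite m), mul_comm, ← nsmul_eq_mul,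
    ← Finset.sum_const]
  refine le_trans (Finset.sum_le_sum fun k hk => ?_) (Finset.sum_le_sum_of_subset_of_nonneg hsub
    fun k _ _ => pairPotential_nonneg (occ_le m k) (occ_le m (k + 1)))
  rw [Set.Finite.mem_toFinset] at hk
  exact spin_le_pairPotential (occ_le _ _) (occ_le _ _) hk.2.1 hk.2.2

/-- The potential is an integer, since `V(m) = 2J ∑ⱼ m(j) - ∑ⱼ m(j) m(j+1)`. -/
lemma exists_int_potential (m : Config twoJ (Fin L)) :
    ∃ z : ℤ, potential m = z := by
  have h : ∀ n : ℕ, ∑ k ∈ Finset.range n, pairPotential twoJ (occ m k) (occ m (k + 1)) +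
      spin twoJ * (occ m 0 + occ m n) = twoJ * ∑ k ∈ Finset.range (n + 1), (occ m k : ℝ) -
        ∑ k ∈ Finset.range n, (occ m k : ℝ) * occ m (k + 1) := by
    intro n
    induction n with
    | zero => simp [spin]; ring
    | succ n ih =>
      rw [Finset.sum_range_succ _ n, Finset.sum_range_succ _ (n + 1),
        Finset.sum_range_succ (fun k => (occ m k : ℝ) * occ m (k + 1)) n]
      unfold pairPotential spin at *
      linarith
  refine ⟨twoJ * ∑ k ∈ Finset.range (L - 1 + 1), (occ m k : ℤ) -
    ∑ k ∈ Finset.range (L - 1), (occ m k : ℤ) * occ m (k + 1), ?_⟩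
  unfold potential
  rw [h]
  push_cast
  rfl

/-- A jump only creates defects next to existing ones, because the bond it crosses is a defect. -/
lemma Adj.exists_defect_near {m n : Config twoJ (Fin L)} (h : Adj m n) {k : ℕ}
    (hk : k ∈ defects n) : ∃ k' ∈ defects m, k ≤ k' + 1 ∧ k' ≤ k + 1 := by
  obtain ⟨i, j, hij, h1, h2⟩ := h
  by_cases hki : k ≤ i + 1 ∧ (i : ℕ) ≤ k + 1
  · refine ⟨i, ⟨?_, ?_, ?_⟩, hki⟩
    · rw [hij]; exact j.2
    all_goals
      rw [hij, occ_coe, occ_coe]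
      have := (m i).2
      have := (m j).2
      have := (n i).2
      have := (n j).2
      omega
  · have he : ∀ q : ℕ, q ≠ i → q ≠ j → occ m q = occ n q := by
      intro q hqi hqj
      unfold occ
      split_ifs with hq
      · rw [h2 ⟨q, hq⟩ (fun h => hqi (by rw [← h])) (fun h => hqj (by rw [← h]))]
      · rfl
    refine ⟨k, ?_, by omega, by omega⟩
    unfold defects at hk ⊢
    rw [Set.mem_ofPred_eq, he k (by omega) (by omega), he (k + 1) (by omega) (by omega)]
    exact hk

/-! ### The spread of the defects -/

/-- The set `S` lies within distance `r` of at most `D` centers. -/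
def Covers (D : ℕ) (S : Set ℕ) (r : ℕ) : Prop :=
  ∃ c : Fin D → ℕ, ∀ k ∈ S, ∃ i, k ≤ c i + r ∧ c i ≤ k + r

/-- The least radius `r` such that `S` lies within distance `r` of at most `D` centers
(with the value `0` if there is none, which does not occur for bounded `S` and `0 < D`). -/
noncomputable def spread (D : ℕ) (S : Set ℕ) : ℕ := sInf {r | Covers D S r}

lemma Covers.spread_le {D r : ℕ} {S : Set ℕ} (h : Covers D S r) : spread D S ≤ r := Nat.sInf_le h

lemma covers_spread {D N : ℕ} (hD : 0 < D) {S : Set ℕ} (hS : S ⊆ Set.Iio N) :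
    Covers D S (spread D S) := by
  refine Nat.sInf_mem (s := {r | Covers D S r}) ⟨N, fun _ => 0, fun k hk => ⟨⟨0, hD⟩, ?_, ?_⟩⟩
  · have := Set.mem_Iio.1 (hS hk)
    simp only
    omega
  · simp only
    omega

lemma Covers.mono {D r : ℕ} {S T : Set ℕ} (hST : S ⊆ T) (h : Covers D T r) : Covers D S r := by
  obtain ⟨c, hc⟩ := h
  exact ⟨c, fun k hk => hc k (hST hk)⟩

lemma spread_mono {D N : ℕ} (hD : 0 < D) {S T : Set ℕ} (hST : S ⊆ T) (hT : T ⊆ Set.Iio N) :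
    spread D S ≤ spread D T :=
  ((covers_spread hD hT).mono hST).spread_le

lemma spread_eq_zero {D : ℕ} {S : Set ℕ} (hS : S.Finite) (h : S.ncard ≤ D) :
    spread D S = 0 := by
  classical
  have := hS.fintype
  have hcard : Fintype.card S ≤ Fintype.card (Fin D) := by
    rwa [Fintype.card_fin, ← Nat.card_eq_fintype_card, Nat.card_coe_set_eq]
  obtain ⟨e⟩ := Function.Embedding.nonempty_of_card_le hcard
  refine Nat.le_zero.1 (Covers.spread_le ⟨Function.extend e Subtype.val (fun _ => 0), fun k hk =>
    ⟨e ⟨k, hk⟩, ?_⟩⟩)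
  rw [e.injective.extend_apply]
  simp

lemma Adj.spread_le {m n : Config twoJ (Fin L)} (h : Adj m n) {D : ℕ} (hD : 0 < D) :
    spread D (defects n) ≤ spread D (defects m) + 1 := by
  obtain ⟨c, hc⟩ := covers_spread hD (defects_subset_range m)
  refine Covers.spread_le ⟨c, fun k hk => ?_⟩
  obtain ⟨k', hk', h1, h2⟩ := h.exists_defect_near hk
  obtain ⟨i, h3, h4⟩ := hc k' hk'
  exact ⟨i, by omega, by omega⟩

/-- A configuration whose defects do not fit into `⌊K / J⌋` points has potential at
least `K + 1`. -/
lemma add_one_le_potential {K D : ℕ}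
    (hKD : (K : ℝ) < spin twoJ * (D + 1)) (m : Config twoJ (Fin L))
    (h : 0 < spread D (defects m)) : (K : ℝ) + 1 ≤ potential m := by
  have hcard : D + 1 ≤ (defects m).ncard := by
    by_contra hlt
    rw [spread_eq_zero (defects_finite m) (by omega)] at h
    exact lt_irrefl _ h
  have hJ0 : 0 ≤ spin twoJ := by unfold spin; positivity
  have h1 : (K : ℝ) < potential m := by
    refine hKD.trans_le (le_trans ?_ (spin_mul_ncard_defects_le m))
    exact mul_le_mul_of_nonneg_left (by exact_mod_cast hcard) hJ0
  obtain ⟨z, hz⟩ := exists_int_potential m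
  rw [hz] at h1 ⊢
  exact_mod_cast h1

/-! ### Localization near configurations with few defects -/

/-- Conjugating `H + W` with a weight `b ^ d`, where `d` changes by at most one along each hop,
costs at most a factor `b` in front of the hopping term, and the form bound `A ≤ 2 V` applies. -/
lemma weighted_form_bound {Δ : ℝ} (hΔ : 0 < Δ) {W : Config twoJ (Fin L) → ℝ} (hW : ∀ m, 0 ≤ W m)
    {b : ℝ} (hb : 1 ≤ b) (hbΔ : b ≤ Δ) {κ : ℝ} (hκ : 0 ≤ κ) (d : Config twoJ (Fin L) → ℕ)
    (hd : ∀ m n, Adj m n → d m ≤ d n + 1) (hdV : ∀ m, 0 < d m → κ ≤ potential m)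
    (u : Config twoJ (Fin L) → ℂ) :
    (1 - b / Δ) * κ * (∑ m, (b ^ d m) ^ 2 * ‖u m‖ ^ 2 - ∑ m, ‖u m‖ ^ 2) ≤
      (star ((Matrix.diagonal (fun m => (((b ^ d m) ^ 2 : ℝ) : ℂ))).mulVec u) ⬝ᵥ
        (hamiltonian Δ W).mulVec u).re := by
  classical
  have hb0 : 0 < b := by linarith
  set v : Config twoJ (Fin L) → ℝ := fun m => b ^ d m * ‖u m‖ with hv
  set a : Config twoJ (Fin L) → Config twoJ (Fin L) → ℝ :=
    fun m n => if Adj m n then weight m n else 0 with ha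
  have ha0 : ∀ m n, 0 ≤ a m n := by
    intro m n
    simp only [ha]
    split_ifs
    · exact Finset.prod_nonneg fun _ _ => Real.sqrt_nonneg _
    · exact le_rfl
  -- the potential part
  have hdiag : star ((Matrix.diagonal (fun m => (((b ^ d m) ^ 2 : ℝ) : ℂ))).mulVec u) ⬝ᵥ
      (Matrix.diagonal (fun m => ((potential m + W m : ℝ) : ℂ))).mulVec u =
      ((∑ m, (potential m + W m) * v m ^ 2 : ℝ) : ℂ) := by
    simp only [dotProduct, Pi.star_apply, RCLike.star_def, Matrix.mulVec_diagonal, map_mul,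
      Complex.conj_ofReal]
    push_cast
    refine Finset.sum_congr rfl fun m _ => ?_
    have h : u m * (starRingEnd ℂ) (u m) = ((‖u m‖ : ℂ)) ^ 2 := by
      rw [Complex.mul_conj, Complex.normSq_eq_norm_sq]; norm_cast
    simp only [hv]
    push_cast
    rw [mul_pow, ← h]; ring
  -- the hopping part
  have hhop : (star ((Matrix.diagonal (fun m => (((b ^ d m) ^ 2 : ℝ) : ℂ))).mulVec u) ⬝ᵥ
      (adjacencyOp twoJ L).mulVec u).re ≤ b * (2 * ∑ m, potential m * v m ^ 2) := by
    refine le_trans ?_ (mul_le_mul_of_nonneg_left (sum_weight_mul_le v) hb0.le)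
    rw [Finset.mul_sum, dotProduct, Complex.re_sum]
    refine Finset.sum_le_sum fun m _ => ?_
    rw [Matrix.mulVec, dotProduct, Finset.mul_sum, Finset.mul_sum, Complex.re_sum]
    refine Finset.sum_le_sum fun n _ => ?_
    have hA : adjacencyOp twoJ L m n = ((a m n : ℝ) : ℂ) := by
      simp only [adjacencyOp, Matrix.of_apply, ha]
      split_ifs <;> simp
    refine (Complex.re_le_norm _).trans ?_
    rw [hA, Pi.star_apply, Matrix.mulVec_diagonal, norm_mul, norm_star, norm_mul, norm_mul,
      Complex.norm_real, Complex.norm_real, Real.norm_of_nonneg (by positivity),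
      Real.norm_of_nonneg (ha0 m n)]
    change _ ≤ b * (a m n * (v m * v n))
    by_cases h : Adj m n
    · have h1 : b ^ d m ≤ b * b ^ d n := by
        rw [← pow_succ']
        exact pow_le_pow_right₀ hb (hd m n h)
      have h2 : 0 ≤ b ^ d m * ‖u m‖ * ‖u n‖ * a m n := by
        have := ha0 m n
        positivity
      have h3 := mul_le_mul_of_nonneg_right h1 h2
      simp only [hv]
      nlinarith
    · have : a m n = 0 := by simp [ha, h]
      rw [this]; simp
  have hHu : (star ((Matrix.diagonal (fun m => (((b ^ d m) ^ 2 : ℝ) : ℂ))).mulVec u) ⬝ᵥ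
      (hamiltonian Δ W).mulVec u).re = -(1 / (2 * Δ)) *
        (star ((Matrix.diagonal (fun m => (((b ^ d m) ^ 2 : ℝ) : ℂ))).mulVec u) ⬝ᵥ
          (adjacencyOp twoJ L).mulVec u).re + ∑ m, (potential m + W m) * v m ^ 2 := by
    have hs : (-(1 / (2 * (Δ : ℂ)))) = ((-(1 / (2 * Δ)) : ℝ) : ℂ) := by push_cast; rfl
    unfold hamiltonian
    rw [Matrix.add_mulVec, dotProduct_add, hdiag, Matrix.smul_mulVec, dotProduct_smul, hs,
      smul_eq_mul, Complex.add_re, Complex.re_ofReal_mul, Complex.ofReal_re]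
  have hVW : ∑ m, potential m * v m ^ 2 ≤ ∑ m, (potential m + W m) * v m ^ 2 :=
    Finset.sum_le_sum fun m _ => mul_le_mul_of_nonneg_right (by linarith [hW m]) (sq_nonneg _)
  have hVκ : κ * (∑ m, (b ^ d m) ^ 2 * ‖u m‖ ^ 2 - ∑ m, ‖u m‖ ^ 2) ≤
      ∑ m, potential m * v m ^ 2 := by
    rw [← Finset.sum_sub_distrib, Finset.mul_sum]
    refine Finset.sum_le_sum fun m _ => ?_
    simp only [hv]
    rw [mul_pow]
    rcases Nat.eq_zero_or_pos (d m) with h0 | h0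
    · rw [h0]
      have := potential_nonneg m
      simp only [pow_zero, one_pow, one_mul, sub_self, mul_zero]
      positivity
    · have h1 := hdV m h0
      have h2 : 0 ≤ (b ^ d m) ^ 2 * ‖u m‖ ^ 2 := by positivity
      nlinarith [mul_le_mul_of_nonneg_right h1 h2, mul_nonneg hκ (sq_nonneg ‖u m‖)]
  rw [hHu]
  have h1 : 1 / (2 * Δ) * (star ((Matrix.diagonal
      (fun m => (((b ^ d m) ^ 2 : ℝ) : ℂ))).mulVec u) ⬝ᵥ (adjacencyOp twoJ L).mulVec u).re ≤
      b / Δ * ∑ m, potential m * v m ^ 2 := by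
    refine (mul_le_mul_of_nonneg_left hhop (by positivity)).trans (le_of_eq ?_)
    field_simp
  have h2 : 0 ≤ 1 - b / Δ := by
    rw [sub_nonneg, div_le_one hΔ]
    exact hbΔ
  have h3 := mul_le_mul_of_nonneg_left hVκ h2
  linarith

/-- States of the spectral subspace have few defects up to a spread whose mean is bounded
uniformly in the length of the chain and in the background potential. -/
lemma exists_spread_bound (hJ : 1 ≤ twoJ) {Δ : ℝ} (hΔ : 2 * spin twoJ < Δ) {K D : ℕ} (hD : 0 < D)
    (hKD : (K : ℝ) < spin twoJ * (D + 1)) {δ : ℝ} (hδ : 0 < δ) :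
    ∃ C : ℝ, 0 ≤ C ∧ ∀ (L : ℕ) (W : Config twoJ (Fin L) → ℝ), (∀ m, 0 ≤ W m) →
      ∀ ψ : Config twoJ (Fin L) → ℂ, (spectralProj Δ K δ W).mulVec ψ = ψ →
        ∑ m, ‖ψ m‖ ^ 2 * (spread D (defects m) : ℝ) ≤ C * ∑ m, ‖ψ m‖ ^ 2 := by
  have h2J : (1 : ℝ) ≤ 2 * spin twoJ := by
    unfold spin
    have : (1 : ℝ) ≤ twoJ := by exact_mod_cast hJ
    linarith
  have hΔ0 : 0 < Δ := by linarith
  have hgap : energy twoJ Δ K δ < (1 - 1 / Δ) * (K + 1) := by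
    unfold energy
    have h1 : 1 / Δ ≤ 2 * spin twoJ / Δ := div_le_div_of_nonneg_right h2J hΔ0.le
    have h2 : 0 < 1 - 2 * spin twoJ / Δ := by
      rw [sub_pos, div_lt_one hΔ0]
      exact hΔ
    have h3 : (0 : ℝ) ≤ K + 1 := by positivity
    nlinarith [mul_pos h2 hδ, mul_le_mul_of_nonneg_right h1 h3]
  obtain ⟨b, hb1, hbΔ, hbE⟩ : ∃ b : ℝ, 1 < b ∧ b < Δ ∧
      energy twoJ Δ K δ < (1 - b / Δ) * (K + 1) := by
    have hcont : Tendsto (fun b : ℝ => (1 - b / Δ) * ((K : ℝ) + 1)) (nhdsWithin 1 (Set.Ioi 1))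
        (nhds ((1 - 1 / Δ) * (K + 1))) :=
      tendsto_nhdsWithin_of_tendsto_nhds (Continuous.tendsto (by fun_prop) 1)
    have h1 := hcont.eventually (lt_mem_nhds hgap)
    have h2 : ∀ᶠ b : ℝ in nhdsWithin 1 (Set.Ioi 1), b < Δ :=
      nhdsWithin_le_nhds (gt_mem_nhds (by linarith))
    obtain ⟨b, hb⟩ := (h1.and (h2.and self_mem_nhdsWithin)).exists
    exact ⟨b, hb.2.2, hb.2.1, hb.1⟩
  set A : ℝ := (1 - b / Δ) * (K + 1) with hA
  set E := energy twoJ Δ K δ with hE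
  have hA0 : 0 < A := by
    have : 0 < 1 - b / Δ := by
      rw [sub_pos, div_lt_one hΔ0]
      exact hbΔ
    positivity
  refine ⟨A / (A - E) / (2 * (b - 1)), div_nonneg (div_nonneg hA0.le (by linarith)) (by linarith),
    fun L W hW ψ hψ => ?_⟩
  have hmain := sum_weight_le (spectralProj_isHermitian Δ K δ W) (spectralProj_mul_self Δ K δ W)
    (hamiltonian_mul_spectralProj_comm Δ K δ W) hA0 hbE
    (re_dotProduct_hamiltonian_le Δ K δ W) (fun m => (b ^ spread D (defects m)) ^ 2)
    (fun u => weighted_form_bound hΔ0 hW hb1.le hbΔ.le (by positivity)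
      (fun m => spread D (defects m)) (fun m n h => h.symm.spread_le hD)
      (fun m h => add_one_le_potential hKD m h) u) ψ hψ
  have hbern : ∀ d : ℕ, 2 * (b - 1) * (d : ℝ) ≤ (b ^ d) ^ 2 := by
    intro d
    have h := one_add_mul_le_pow (a := b - 1) (by linarith) (d * 2)
    rw [add_sub_cancel, pow_mul] at h
    push_cast at h
    linarith
  rw [div_mul_eq_mul_div, le_div_iff₀ (by linarith)]
  refine le_trans ?_ hmain
  rw [Finset.sum_mul]
  refine Finset.sum_le_sum fun m _ => ?_
  have := mul_le_mul_of_nonneg_right (hbern (spread D (defects m))) (sq_nonneg ‖ψ m‖)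
  linarith

/-! ### Counting configurations of the left sites -/

/-- The number of particles at site `k` of a configuration of the first `ℓ` sites, as an element
of `Fin (2J + 1)` (and `0` at all other `k`). -/
def leftOcc {ℓ : ℕ} (X : Config twoJ (LeftSites L ℓ)) (k : ℕ) : Fin (twoJ + 1) :=
  if h : k < L ∧ k < ℓ then X ⟨⟨k, h.1⟩, h.2⟩ else 0

/-- The defects of a configuration of the first `ℓ` sites, on bonds inside this block. -/
def leftDefects {ℓ : ℕ} (X : Config twoJ (LeftSites L ℓ)) : Set ℕ :=
  {k | k + 1 < L ∧ k + 1 < ℓ ∧ ¬ ((leftOcc X k : ℕ) = 0 ∧ (leftOcc X (k + 1) : ℕ) = 0) ∧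
    ¬ ((leftOcc X k : ℕ) = twoJ ∧ (leftOcc X (k + 1) : ℕ) = twoJ)}

lemma leftDefects_subset {ℓ : ℕ} (X : Config twoJ (LeftSites L ℓ)) :
    leftDefects X ⊆ Set.Iio ℓ := by
  intro k hk
  have := hk.2.1
  simp only [Set.mem_Iio]
  omega

lemma leftDefects_leftPart_subset (ℓ : ℕ) (m : Config twoJ (Fin L)) :
    leftDefects (leftPart ℓ m) ⊆ defects m := by
  intro k hk
  have h : ∀ q, q < L → q < ℓ → (leftOcc (leftPart ℓ m) q : ℕ) = occ m q := by
    intro q h1 h2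
    simp [leftOcc, leftPart, occ, h1, h2]
  obtain ⟨h1, h2, h3, h4⟩ := hk
  rw [h k (by omega) (by omega), h (k + 1) h1 h2] at h3 h4
  exact ⟨h1, h3, h4⟩

/-- A configuration is determined by its value at the first site and its values next to its
defects. -/
lemma eq_of_leftOcc_eq {ℓ : ℕ} {X X' : Config twoJ (LeftSites L ℓ)}
    (h0 : leftOcc X 0 = leftOcc X' 0)
    (h : ∀ k ∈ leftDefects X ∪ leftDefects X', leftOcc X (k + 1) = leftOcc X' (k + 1)) :
    X = X' := by
  have key : ∀ k, leftOcc X k = leftOcc X' k := by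
    intro k
    induction k with
    | zero => exact h0
    | succ k ih =>
      by_cases hk : k + 1 < L ∧ k + 1 < ℓ
      · by_cases hX : k ∈ leftDefects X
        · exact h k (Or.inl hX)
        by_cases hX' : k ∈ leftDefects X'
        · exact h k (Or.inr hX')
        have step : ∀ Y : Config twoJ (LeftSites L ℓ), k ∉ leftDefects Y →
            leftOcc Y (k + 1) = leftOcc Y k := by
          intro Y hY
          by_contra hne
          refine hY ⟨hk.1, hk.2, fun h => hne ?_, fun h => hne ?_⟩ <;>
            exact Fin.ext (h.2.trans h.1.symm)
        rw [step X hX, step X' hX', ih]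
      · simp [leftOcc, hk]
  funext i
  have := key i
  simpa [leftOcc, i.2] using this

open Classical in
lemma card_covers_le {D ℓ : ℕ} (hℓ : 1 ≤ ℓ) (r : ℕ) :
    Fintype.card {X : Config twoJ (LeftSites L ℓ) // Covers D (leftDefects X) r} ≤
      ℓ ^ D * ((twoJ + 1) ^ (2 * D + 2)) ^ (r + 1) := by
  have hex : ∀ X : {X : Config twoJ (LeftSites L ℓ) // Covers D (leftDefects X) r},
      ∃ c : Fin D → Fin ℓ, ∀ k ∈ leftDefects X.1, ∃ i, k ≤ c i + r ∧ (c i : ℕ) ≤ k + r := by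
    rintro ⟨X, c, hc⟩
    -- centers beyond the block are moved to its last site
    refine ⟨fun i => ⟨min (c i) (ℓ - 1), by omega⟩, fun k hk => ?_⟩
    obtain ⟨i, h1, h2⟩ := hc k hk
    have := hk.2.1
    exact ⟨i, by simp only; omega, by simp only; omega⟩
  choose c hc using hex
  let Φ : {X : Config twoJ (LeftSites L ℓ) // Covers D (leftDefects X) r} →
      (Fin D → Fin ℓ) × Fin (twoJ + 1) × (Fin D × Fin (2 * r + 2) → Fin (twoJ + 1)) :=
    fun X => (c X, leftOcc X.1 0, fun p => leftOcc X.1 ((c X p.1 : ℕ) + p.2 - r))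
  have hΦ : Function.Injective Φ := by
    intro X X' hXX'
    have e1 : c X = c X' := congrArg Prod.fst hXX'
    have e2 : leftOcc X.1 0 = leftOcc X'.1 0 := congrArg (fun t => t.2.1) hXX'
    have e3 : ∀ i (s : Fin (2 * r + 2)), leftOcc X.1 ((c X i : ℕ) + s - r) =
        leftOcc X'.1 ((c X' i : ℕ) + s - r) := fun i s =>
      congrFun (congrArg (fun t => t.2.2) hXX') (i, s)
    refine Subtype.ext (eq_of_leftOcc_eq e2 fun k hk => ?_)
    have : ∃ i, k ≤ c X i + r ∧ (c X i : ℕ) ≤ k + r := by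
      rcases hk with hk | hk
      · exact hc X k hk
      · rw [e1]
        exact hc X' k hk
    obtain ⟨i, h1, h2⟩ := this
    have h3 := e3 i ⟨k + 1 + r - c X i, by omega⟩
    rw [← e1] at h3
    have h4 : (c X i : ℕ) + (k + 1 + r - c X i) - r = k + 1 := by omega
    simpa only [h4] using h3
  refine (Fintype.card_le_of_injective Φ hΦ).trans ?_
  simp only [Fintype.card_prod, Fintype.card_fun, Fintype.card_fin]
  refine Nat.mul_le_mul_left _ ?_
  rw [← pow_succ', ← pow_mul]
  refine Nat.pow_le_pow_right (Nat.succ_pos _) ?_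
  nlinarith

/-- If at most `N B ^ (r + 1)` points have `d = r`, the weights `N⁻¹ (2 B) ^ (-(d + 1))` form a
subprobability. -/
lemma sum_inv_le_one {ι : Type} [Fintype ι] (d : ι → ℕ) {N B : ℝ} (hN : 0 < N) (hB : 0 < B)
    (h : ∀ r, ((Finset.univ.filter fun x => d x = r).card : ℝ) ≤ N * B ^ (r + 1)) :
    ∑ x, (N * (2 * B) ^ (d x + 1))⁻¹ ≤ 1 := by
  have hgeom : ∀ R : ℕ, ∑ r ∈ Finset.range R, ((2 : ℝ) ^ (r + 1))⁻¹ ≤ 1 - (2 ^ R)⁻¹ := by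
    intro R
    induction R with
    | zero => simp
    | succ R ih =>
      rw [Finset.sum_range_succ]
      have : ((2 : ℝ) ^ R)⁻¹ = 2 * (2 ^ (R + 1))⁻¹ := by
        rw [pow_succ, mul_inv]; ring
      linarith
  set R := Finset.univ.sup d + 1 with hR
  have hmap : ∀ x ∈ (Finset.univ : Finset ι), d x ∈ Finset.range R := fun x hx =>
    Finset.mem_range.2 (Nat.lt_succ_of_le (Finset.le_sup (f := d) hx))
  rw [← Finset.sum_fiberwise_of_maps_to hmap]
  calc _ ≤ ∑ r ∈ Finset.range R, ((2 : ℝ) ^ (r + 1))⁻¹ := by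
        refine Finset.sum_le_sum fun r _ => ?_
        rw [Finset.sum_congr rfl (g := fun _ => (N * (2 * B) ^ (r + 1))⁻¹)
          (fun x hx => by rw [(Finset.mem_filter.1 hx).2]), Finset.sum_const, nsmul_eq_mul]
        refine (mul_le_mul_of_nonneg_right (h r) (by positivity)).trans (le_of_eq ?_)
        rw [mul_pow]
        field_simp
    _ ≤ 1 := (hgeom R).trans (by
        have : (0 : ℝ) ≤ (2 ^ R)⁻¹ := by positivity
        linarith)

/-! ### The entropy bound -/

/-- The entropy of normalized states of the spectral subspace is at most `⌊K / J⌋ log ℓ` up to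
a constant that depends neither on `ℓ` and `L` nor on the background potential. -/
theorem exists_entanglementEntropy_le (hJ : 1 ≤ twoJ) {Δ : ℝ} (hΔ : 2 * spin twoJ < Δ) {K D : ℕ}
    (hD : 0 < D) (hKD : (K : ℝ) < spin twoJ * (D + 1)) {δ : ℝ} (hδ : 0 < δ) :
    ∃ C : ℝ, ∀ (L ℓ : ℕ), 1 ≤ ℓ → ∀ W : Config twoJ (Fin L) → ℝ, (∀ m, 0 ≤ W m) →
      ∀ ψ : EuclideanSpace ℂ (Config twoJ (Fin L)),
        ψ ∈ LinearMap.range (Matrix.toEuclideanLin (spectralProj Δ K δ W)) → ‖ψ‖ = 1 →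
          entanglementEntropy ℓ ψ ≤ D * Real.log ℓ + C := by
  classical
  obtain ⟨C, hC0, hC⟩ := exists_spread_bound hJ hΔ hD hKD hδ
  set B : ℝ := ((twoJ : ℝ) + 1) ^ (2 * D + 2) with hB
  have hB1 : 1 ≤ B := one_le_pow₀ (by linarith [Nat.cast_nonneg (α := ℝ) twoJ])
  have hB0 : 0 < B := by linarith
  have hlog : 0 ≤ Real.log (2 * B) := Real.log_nonneg (by linarith)
  refine ⟨(C + 1) * Real.log (2 * B), fun L ℓ hℓ W hW ψ hψ hnorm => ?_⟩
  have hℓ0 : (0 : ℝ) < ℓ := by exact_mod_cast hℓ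
  have hQψ : (spectralProj Δ K δ W).mulVec ψ.ofLp = ψ.ofLp := by
    obtain ⟨φ, rfl⟩ := hψ
    rw [Matrix.ofLp_toLpLin, Matrix.toLin'_apply, Matrix.mulVec_mulVec, spectralProj_mul_self]
  have hψ1 : ∑ m, ‖ψ m‖ ^ 2 = 1 := by
    rw [← EuclideanSpace.norm_sq_eq, hnorm, one_pow]
  set d : Config twoJ (LeftSites L ℓ) → ℕ := fun X => spread D (leftDefects X) with hd
  set q : Config twoJ (LeftSites L ℓ) → ℝ :=
    fun X => ((ℓ : ℝ) ^ D * (2 * B) ^ (d X + 1))⁻¹ with hq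
  have hq0 : ∀ X, 0 < q X := fun X => by simp only [hq]; positivity
  have hq1 : ∑ X, q X ≤ 1 := by
    refine sum_inv_le_one d (by positivity) hB0 fun r => ?_
    have h1 : (Finset.univ.filter fun X => d X = r).card ≤
        Fintype.card {X : Config twoJ (LeftSites L ℓ) // Covers D (leftDefects X) r} := by
      rw [Fintype.card_subtype]
      refine Finset.card_le_card fun X hX => ?_
      have hX := (Finset.mem_filter.1 hX).2
      refine Finset.mem_filter.2 ⟨Finset.mem_univ _, ?_⟩
      rw [← hX]
      exact covers_spread hD (leftDefects_subset X)
    have h2 := h1.trans (card_covers_le hℓ r)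
    rw [hB]
    exact_mod_cast h2
  have htr : ∑ X, (reducedState ℓ ψ X X).re = 1 := by
    have := sum_reducedState_diag ℓ ψ (fun _ => 1)
    simpa [hψ1] using this
  have hlogq : ∀ X, -Real.log (q X) = D * Real.log ℓ + (d X + 1) * Real.log (2 * B) := by
    intro X
    simp only [hq]
    rw [Real.log_inv, neg_neg, Real.log_mul (by positivity) (by positivity), Real.log_pow,
      Real.log_pow]
    push_cast
    ring
  calc entanglementEntropy ℓ ψ
      ≤ ∑ X, (reducedState ℓ ψ X X).re * (-Real.log (q X)) :=
        vonNeumannEntropy_le (reducedState_posSemidef ℓ ψ) htr q hq0 hq1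
    _ = ∑ m, ‖ψ m‖ ^ 2 * (-Real.log (q (leftPart ℓ m))) := sum_reducedState_diag ℓ ψ _
    _ ≤ ∑ m, ‖ψ m‖ ^ 2 * (D * Real.log ℓ + (spread D (defects m) + 1) * Real.log (2 * B)) := by
        refine Finset.sum_le_sum fun m _ => mul_le_mul_of_nonneg_left ?_ (sq_nonneg _)
        rw [hlogq]
        have h1 : (d (leftPart ℓ m) : ℝ) ≤ spread D (defects m) := by
          exact_mod_cast spread_mono hD (leftDefects_leftPart_subset ℓ m) (defects_subset_range m)
        have := mul_le_mul_of_nonneg_right h1 hlog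
        linarith
    _ = (∑ m, ‖ψ m‖ ^ 2) * (D * Real.log ℓ + Real.log (2 * B)) +
          (∑ m, ‖ψ m‖ ^ 2 * (spread D (defects m) : ℝ)) * Real.log (2 * B) := by
        rw [Finset.sum_mul, Finset.sum_mul, ← Finset.sum_add_distrib]
        exact Finset.sum_congr rfl fun m _ => by ring
    _ ≤ D * Real.log ℓ + (C + 1) * Real.log (2 * B) := by
        have h1 := hC L W hW ψ.ofLp hQψ
        rw [hψ1, mul_one] at h1
        have := mul_le_mul_of_nonneg_right h1 hlog
        rw [hψ1]
        linarith

end XXZ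

theorem theorem3p8 (twoJ : ℕ) (hJ : 1 ≤ twoJ) (Δ : ℝ) (hΔ : 2 * XXZ.spin twoJ < Δ)
    (K : ℕ) (hK : 4 * XXZ.spin twoJ ^ 2 ≤ (K : ℝ)) (δ : ℝ) (hδ : 0 < δ) :
    limsup (fun ℓ : ℕ =>
        limsup (fun L : ℕ =>
          XXZ.maxEntropy twoJ Δ K δ L ℓ / ((Real.log (ℓ : ℝ) : ℝ) : EReal)) atTop) atTop ≤
      ((2 * (⌊(K : ℝ) / XXZ.spin twoJ⌋ : ℝ) - 2 : ℝ) : EReal) := by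
  have hJ0 : (0 : ℝ) < XXZ.spin twoJ := by
    unfold XXZ.spin
    have : (0 : ℝ) < twoJ := by exact_mod_cast hJ
    positivity
  have h2J : (1 : ℝ) ≤ 2 * XXZ.spin twoJ := by
    unfold XXZ.spin
    have : (1 : ℝ) ≤ twoJ := by exact_mod_cast hJ
    linarith
  set D := ⌊(K : ℝ) / XXZ.spin twoJ⌋₊ with hD
  -- `K / J ≥ 4J ≥ 2`, so that `D ≤ 2D - 2`
  have hD2 : 2 ≤ D := by
    refine Nat.le_floor ?_
    rw [le_div_iff₀ hJ0]
    push_cast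
    nlinarith
  have hfloor : (⌊(K : ℝ) / XXZ.spin twoJ⌋ : ℝ) = D :=
    (natCast_floor_eq_intCast_floor (by positivity)).symm
  have hKD : (K : ℝ) < XXZ.spin twoJ * (D + 1) := by
    have := Nat.lt_floor_add_one ((K : ℝ) / XXZ.spin twoJ)
    rwa [div_lt_iff₀ hJ0, mul_comm] at this
  obtain ⟨C, hC⟩ := XXZ.exists_entanglementEntropy_le hJ hΔ (by omega) hKD hδ
  have hbound : ∀ ℓ : ℕ, 2 ≤ ℓ → limsup (fun L : ℕ =>
      XXZ.maxEntropy twoJ Δ K δ L ℓ / ((Real.log (ℓ : ℝ) : ℝ) : EReal)) atTop ≤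
        ((D + C / Real.log ℓ : ℝ) : EReal) := by
    intro ℓ hℓ
    have hlog : 0 < Real.log ℓ := Real.log_pos (by exact_mod_cast hℓ)
    refine limsup_le_of_le (h := Eventually.of_forall fun L => ?_)
    have h1 : XXZ.maxEntropy twoJ Δ K δ L ℓ ≤ ((D * Real.log ℓ + C : ℝ) : EReal) :=
      iSup_le fun W => iSup_le fun hW => iSup_le fun ψ => iSup_le fun hψ => iSup_le fun h =>
        EReal.coe_le_coe_iff.2 (hC L ℓ (by omega) W hW ψ hψ h)
    refine (EReal.div_le_div_right_of_nonneg (EReal.coe_nonneg.2 hlog.le) h1).trans (le_of_eq ?_)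
    rw [← EReal.coe_div]
    congr 1
    field_simp
  have hlim : Tendsto (fun ℓ : ℕ => ((D + C / Real.log ℓ : ℝ) : EReal)) atTop
      (nhds ((D + 0 : ℝ) : EReal)) :=
    (continuous_coe_real_ereal.tendsto _).comp (tendsto_const_nhds.add
      (tendsto_const_nhds.div_atTop (Real.tendsto_log_atTop.comp tendsto_natCast_atTop_atTop)))
  calc _ ≤ limsup (fun ℓ : ℕ => ((D + C / Real.log ℓ : ℝ) : EReal)) atTop :=
        limsup_le_limsup ((eventually_ge_atTop 2).mono hbound)
    _ = ((D + 0 : ℝ) : EReal) := hlim.limsup_eq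
    _ ≤ _ := by
        rw [hfloor, EReal.coe_le_coe_iff]
        have : (2 : ℝ) ≤ D := by exact_mod_cast hD2
        linarith
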